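/- **Theorem 3 (high-noise limit).** Consider a chain of nodes $0,1,\dots,m$ ($m\ge1$). Node $0$ is given a uniformly distributed bit $\Theta\in\{0,1\}$. At each time $i\in\{1,\dots,n\}$, each node $j\in\{0,\dots,m-1\}$ sends one bit $X_{i,j}$ to node $j+1$ through a binary symmetric channel with crossover probability $p\in(0,\frac12)$, with output $Y_{i,j}$; the channels are memoryless and independent across nodes. A protocol of block length $n$ specifies each $X_{i,0}$ as a function of $\Theta$, each $X_{i,j}$ with $1\le j\le m-1$ as a function of $Y_{1,j-1},\dots,Y_{i-1,j-1}$, and an estimate $\hat\Theta$ as a function of $Y_{1,m-1},\dots,Y_{n,m-1}$. For $\epsilon\in(0,\frac12)$ let $n^*_\epsilon(m,p)$ be the minimum block length $n$ for which some protocol has $\mathbb P(\hat\Theta\ne\Theta)\le\epsilon$, and define the (lower and upper) information velocities $$\underline v_\epsilon(p)=\liminf_{m\to\infty}\frac{m}{n^*_\epsilon(m,p)},\qquad \overline v_\epsilon(p)=\limsup_{m\to\infty}\frac{m}{n^*_\epsilon(m,p)} ;$$ the information velocity $v(p)=\lim_{m\to\infty} m/n^*_{1/3}(m,p)$, when the limit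 exists, is their common value for $\epsilon=\frac13$. Let also $\underline v_0(p)$ and $\overline v_0(p)$ be the suprema of $\liminf_{m\to\infty} m/n_m$ and of $\limsup_{m\to\infty} m/n_m$, respectively, over all sequences of block lengths $(n_m)$ for which there are protocols over $m$ hops with block length $n_m$ and $\mathbb P(\hat\Theta\ne\Theta)\to0$ as $m\to\infty$. Then, as $\delta\to0^+$, the information velocity is of order $\delta^2$: for every fixed $\epsilon\in(0,\frac12)$ (in particular $\epsilon=\frac13$), $$\underline v_\epsilon\Big(\frac{1-\delta}2\Big)=\Theta(\delta^2)\quad\text{and}\quad \overline v_\epsilon\Big(\frac{1-\delta}2\Big)=\Theta(\delta^2),$$ and likewise $$\underline v_0\Big(\frac{1-\delta}2\Big)=\Theta(\delta^2)\quad\text{and}\quad \overline v_0\Big(\frac{1-\delta}2\Big)=\Theta(\delta^2).$$ -/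

import Mathlib

open Filter Topology Asymptotics

noncomputable section

namespace BitRelay

/-- A (deterministic) protocol relaying one bit through `r` relays, i.e. over `m = r + 1` hops, with
block length `n`. The nodes are `0, …, r + 1`; node `0` is the encoder, node `r + 1` the decoder.
Times are indexed by `Fin n`, starting at `0`.
* `encode θ i`: the bit that node `0` sends at time `i` when the message is `θ`;
* `relay k i h`: the bit that relay node `k + 1` sends at time `i`, where `h` is the sequence of the
  `i` bits that it received strictly before time `i`;
* `decode h`: the estimate that node `r + 1` forms from the `n` bits it received. -/
structure Protocol (r n : ℕ) where
  encode : Bool → Fin n → Bool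
  relay : Fin r → (i : Fin n) → (Fin i → Bool) → Bool
  decode : (Fin n → Bool) → Bool

/-- Transition probability of the binary symmetric channel with crossover probability `p`
from the input `x` to the output `y`. -/
def bsc (p : ℝ) (x y : Bool) : ℝ := if y = x then 1 - p else p

namespace Protocol

variable {r n : ℕ}

/-- The channel input `X i j`, sent by node `j` to node `j + 1` at time `i`, when the message is `θ`
and the channel outputs are `y`; here `y i j` is received by node `j + 1` at time `i`. -/
def sent (P : Protocol r n) (θ : Bool) (y : Fin n → Fin (r + 1) → Bool)
    (i : Fin n) (j : Fin (r + 1)) : Bool :=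
  Fin.cases (P.encode θ i)
    (fun k => P.relay k i (fun t => y (Fin.castLE i.isLt.le t) k.castSucc)) j

/-- Conditional probability of the table `y` of all channel outputs, given the message `θ`:
the channels are memoryless and independent across nodes. -/
def outputProb (P : Protocol r n) (p : ℝ) (θ : Bool) (y : Fin n → Fin (r + 1) → Bool) : ℝ :=
  ∏ i, ∏ j, bsc p (P.sent θ y i j) (y i j)

/-- The error probability of the protocol for a uniformly distributed message bit. -/
def errorProb (P : Protocol r n) (p : ℝ) : ℝ :=
  ∑ θ : Bool, (1 / 2 : ℝ) * ∑ y : Fin n → Fin (r + 1) → Bool,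
    if P.decode (fun i => y i (Fin.last r)) ≠ θ then P.outputProb p θ y else 0

end Protocol

/-- The minimum block length with which one bit can be sent over `r + 1` hops with error
probability at most `ε`. -/
def minBlockLength (ε p : ℝ) (r : ℕ) : ℕ :=
  sInf {n : ℕ | ∃ P : Protocol r n, P.errorProb p ≤ ε}

/-- Lower information velocity: `liminf m / n*(m, p)` as the number `m = r + 1` of hops grows, where
`n*(m, p)` refers to error probability at most `ε`. -/
def lowerVelocity (ε p : ℝ) : ℝ :=
  liminf (fun r : ℕ => ((r + 1 : ℕ) : ℝ) / (minBlockLength ε p r : ℝ)) atTop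

/-- Upper information velocity: `limsup m / n*(m, p)`. -/
def upperVelocity (ε p : ℝ) : ℝ :=
  limsup (fun r : ℕ => ((r + 1 : ℕ) : ℝ) / (minBlockLength ε p r : ℝ)) atTop

/-- The block lengths `n r` (for `m = r + 1` hops) allow protocols with vanishing error
probability. -/
def HasVanishingError (p : ℝ) (n : ℕ → ℕ) : Prop :=
  ∃ P : (r : ℕ) → Protocol r (n r), Tendsto (fun r => (P r).errorProb p) atTop (𝓝 0)

/-- Lower information velocity under vanishing error probability: the supremum of
`liminf m / n_m` over all block length sequences that allow vanishing error probability. -/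
def lowerVanishingVelocity (p : ℝ) : ℝ :=
  sSup {v : ℝ | ∃ n : ℕ → ℕ, HasVanishingError p n ∧
    v = liminf (fun r : ℕ => ((r + 1 : ℕ) : ℝ) / (n r : ℝ)) atTop}

/-- Upper information velocity under vanishing error probability: as `lowerVanishingVelocity`,
with `limsup`. -/
def upperVanishingVelocity (p : ℝ) : ℝ :=
  sSup {v : ℝ | ∃ n : ℕ → ℕ, HasVanishingError p n ∧
    v = limsup (fun r : ℕ => ((r + 1 : ℕ) : ℝ) / (n r : ℝ)) atTop}

end BitRelay

end

namespace BitRelay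

/-! For every `δ ∈ (0,1)` each velocity lies between `δ ^ 2 / 756` and `2 * δ ^ 2`; the theorem
follows at once.

Converse. Let `I_k(i)` be the chi-squared information about the message in the first `i` bits
received by node `k`. The bit that the next node receives at time `i` is a noisy copy of a function
of the first `i` bits of its predecessor. Contraction by `δ²` in the channel (`bsc_contraction`) and
data processing give `I_{k+1}(i+1) ≤ (1-δ²) I_{k+1}(i) + δ² I_k(i)` (`chiInfo_pushLaw_succ_le`).
This recursion turns a bound `B (1+δ²)^i` into `(B/2) (1+δ²)^i`, so every relay halves the constant.
Over `r` relays, Cauchy-Schwarz yields `(1 - 2 Pₑ)² ≤ (1+δ²)^n / 2^r`, which forces `n` to be at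
least of order `r/δ²`.

Achievability. Order `1/δ²` repetitions make one hop reliable up to a small constant error. Then
iterate `Achieves.amplify`: repeating a chain three times with a majority vote takes the error from
`ε` to order `ε^{3/2}` and triples the window length `τ` but not the delays; joining four copies
multiplies the hops by 4 at the price of three further delays of one window. The hops grow like
`4^k` and the windows only like `3^k`, so the total time stays linear in the number of hops
(`exists_achieves_pow`), while the error falls like `4^{-k}`. -/

/-- Expectation of `g` applied to the output of the memoryless binary symmetric channel with
crossover probability `p` and input block `x`. -/
noncomputable def bscExp {ι : Type*} [Fintype ι] [DecidableEq ι] (p : ℝ) (x : ι → Bool)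
    (g : (ι → Bool) → ℝ) : ℝ :=
  ∑ c, (∏ i, bsc p (x i) (c i)) * g c

/-- Expectation of `g` applied to the last block, when the received block `c` is processed
successively by the maps `fs`, each followed by a binary symmetric channel. -/
noncomputable def chainExp {ι : Type*} [Fintype ι] [DecidableEq ι] (p : ℝ) :
    List ((ι → Bool) → ι → Bool) → ((ι → Bool) → ℝ) → (ι → Bool) → ℝ
  | [], g => g
  | f :: fs, g => fun c => bscExp p (f c) (chainExp p fs g)

/-! ### Expectations over one block transmission and along a chain -/

section basic

variable {ι κ : Type*} [Fintype ι] {p : ℝ}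

lemma bsc_nonneg (h0 : 0 ≤ p) (h1 : p ≤ 1) (x y : Bool) : 0 ≤ bsc p x y := by
  unfold bsc; split_ifs <;> linarith

lemma sum_bsc (p : ℝ) (x : Bool) : ∑ y, bsc p x y = 1 := by
  cases x <;> simp [bsc]

lemma prod_bsc_nonneg (h0 : 0 ≤ p) (h1 : p ≤ 1) (x c : ι → Bool) :
    0 ≤ ∏ i, bsc p (x i) (c i) :=
  Finset.prod_nonneg fun _ _ => bsc_nonneg h0 h1 _ _

variable [DecidableEq ι] [Fintype κ]

lemma sum_prod_bsc (p : ℝ) (x : ι → Bool) : ∑ c : ι → Bool, ∏ i, bsc p (x i) (c i) = 1 := by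
  rw [← Fintype.piFinset_univ, ← Finset.prod_univ_sum]
  simp only [sum_bsc, Finset.prod_const_one]

/-- The output law of a subfamily of the channel uses. -/
lemma sum_prod_bsc_comp_eq (p : ℝ) (e : κ → ι) (he : Function.Injective e) (x : ι → Bool)
    (h : κ → Bool) :
    ∑ c : ι → Bool, (∏ i, bsc p (x i) (c i)) * (if c ∘ e = h then 1 else 0)
      = ∏ k, bsc p (x (e k)) (h k) := by
  classical
  have hset : (Finset.univ.filter fun c : ι → Bool => c ∘ e = h)
      = Fintype.piFinset fun i => Finset.univ.filter fun b : Bool => ∀ k, e k = i → b = h k := by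
    ext c
    simp only [Finset.mem_filter, Finset.mem_univ, true_and, Fintype.mem_piFinset, funext_iff,
      Function.comp_apply]
    constructor
    · rintro hc i k rfl; exact hc k
    · intro hc k; exact hc _ k rfl
  simp only [mul_ite, mul_one, mul_zero]
  rw [← Finset.sum_filter, hset, ← Finset.prod_univ_sum]
  symm
  refine Finset.prod_of_injOn e he.injOn (by simp) ?_ ?_
  · intro i _ hi
    have : (Finset.univ.filter fun b : Bool => ∀ k, e k = i → b = h k) = Finset.univ := by
      refine Finset.filter_true_of_mem fun b _ k hk => ?_
      exact absurd ⟨k, by simp, hk⟩ hi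
    rw [this, sum_bsc]
  · intro k _
    have : (Finset.univ.filter fun b : Bool => ∀ k', e k' = e k → b = h k') = {h k} := by
      ext b
      simp only [Finset.mem_filter, Finset.mem_univ, true_and, Finset.mem_singleton]
      constructor
      · intro hb; exact hb k rfl
      · rintro rfl k' hk'; rw [he hk']
    rw [this, Finset.sum_singleton]

lemma bscExp_comp [DecidableEq κ] (p : ℝ) (e : κ → ι) (he : Function.Injective e) (x : ι → Bool)
    (g : (κ → Bool) → ℝ) :
    bscExp p x (fun c => g (c ∘ e)) = bscExp p (x ∘ e) g := by
  unfold bscExp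
  simp only [Function.comp_apply, ← sum_prod_bsc_comp_eq p e he x, Finset.sum_mul]
  rw [Finset.sum_comm]
  refine Finset.sum_congr rfl fun c _ => ?_
  rw [Finset.sum_eq_single (c ∘ e)]
  · simp
  · intro b _ hb
    rw [if_neg (Ne.symm hb)]; simp
  · simp

lemma bscExp_const (p : ℝ) (x : ι → Bool) (a : ℝ) : bscExp p x (fun _ => a) = a := by
  rw [bscExp, ← Finset.sum_mul, sum_prod_bsc, one_mul]

lemma bscExp_mono (h0 : 0 ≤ p) (h1 : p ≤ 1) (x : ι → Bool) {g g' : (ι → Bool) → ℝ}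
    (h : ∀ c, g c ≤ g' c) : bscExp p x g ≤ bscExp p x g' :=
  Finset.sum_le_sum fun c _ => mul_le_mul_of_nonneg_left (h c) (prod_bsc_nonneg h0 h1 x c)

lemma bscExp_add (p : ℝ) (x : ι → Bool) (g g' : (ι → Bool) → ℝ) :
    bscExp p x (fun c => g c + g' c) = bscExp p x g + bscExp p x g' := by
  simp only [bscExp, mul_add, Finset.sum_add_distrib]

lemma bscExp_const_mul (p : ℝ) (x : ι → Bool) (a : ℝ) (g : (ι → Bool) → ℝ) :
    bscExp p x (fun c => a * g c) = a * bscExp p x g := by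
  simp only [bscExp, Finset.mul_sum]
  exact Finset.sum_congr rfl fun c _ => by ring

lemma chainExp_mono (h0 : 0 ≤ p) (h1 : p ≤ 1) (fs : List ((ι → Bool) → ι → Bool))
    {g g' : (ι → Bool) → ℝ} (h : ∀ c, g c ≤ g' c) (c : ι → Bool) :
    chainExp p fs g c ≤ chainExp p fs g' c := by
  induction fs generalizing c with
  | nil => exact h c
  | cons f fs ih => exact bscExp_mono h0 h1 _ ih

lemma chainExp_const (p : ℝ) (fs : List ((ι → Bool) → ι → Bool)) (a : ℝ) :
    chainExp p fs (fun _ => a) = fun _ => a := by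
  induction fs with
  | nil => rfl
  | cons f fs ih => funext c; simp only [chainExp, ih, bscExp_const]

lemma chainExp_add (p : ℝ) (fs : List ((ι → Bool) → ι → Bool)) (g g' : (ι → Bool) → ℝ) :
    chainExp p fs (fun c => g c + g' c) = fun c => chainExp p fs g c + chainExp p fs g' c := by
  induction fs with
  | nil => rfl
  | cons f fs ih => funext c; simp only [chainExp, ih, bscExp_add]

lemma chainExp_const_mul (p : ℝ) (fs : List ((ι → Bool) → ι → Bool)) (a : ℝ)
    (g : (ι → Bool) → ℝ) :
    chainExp p fs (fun c => a * g c) = fun c => a * chainExp p fs g c := by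
  induction fs with
  | nil => rfl
  | cons f fs ih => funext c; simp only [chainExp, ih, bscExp_const_mul]

lemma chainExp_append (p : ℝ) (fs fs' : List ((ι → Bool) → ι → Bool)) (g : (ι → Bool) → ℝ) :
    chainExp p (fs ++ fs') g = chainExp p fs (chainExp p fs' g) := by
  induction fs with
  | nil => rfl
  | cons f fs ih => funext c; simp only [List.cons_append, chainExp, ih]

/-- Error probability, given the message `θ`, of a chain with encoder `enc`, relay maps `fs`
and decoder `dec`. -/
noncomputable def condError (p : ℝ) (enc : Bool → ι → Bool) (fs : List ((ι → Bool) → ι → Bool))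
    (dec : (ι → Bool) → Bool) (θ : Bool) : ℝ :=
  bscExp p (enc θ) (chainExp p fs fun c => if dec c ≠ θ then 1 else 0)

lemma condError_nonneg (h0 : 0 ≤ p) (h1 : p ≤ 1) (enc : Bool → ι → Bool)
    (fs : List ((ι → Bool) → ι → Bool)) (dec : (ι → Bool) → Bool) (θ : Bool) :
    0 ≤ condError p enc fs dec θ := by
  calc (0 : ℝ) = bscExp p (enc θ) (chainExp p fs fun _ => 0) := by
        rw [chainExp_const, bscExp_const]
    _ ≤ _ := bscExp_mono h0 h1 _ (chainExp_mono h0 h1 _ fun c => by split_ifs <;> norm_num)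

end basic

/-! ### Protocols as chains of causal block maps -/

section protocol

variable {n : ℕ}

/-- `f` computes each output bit from the input bits that come less than `d` positions after it. -/
def Causal (d : ℕ) (f : (Fin n → Bool) → Fin n → Bool) : Prop :=
  ∀ (i : Fin n) (c₁ c₂ : Fin n → Bool),
    (∀ k : Fin n, (k : ℕ) < i + d → c₁ k = c₂ k) → f c₁ i = f c₂ i

/-- The block sent by relay `k` of the protocol as a function of the block it receives. -/
def Protocol.relayMap {r : ℕ} (P : Protocol r n) (k : Fin r) (c : Fin n → Bool) (i : Fin n) :
    Bool :=
  P.relay k i fun t => c (Fin.castLE i.isLt.le t)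

lemma Protocol.relayMap_causal {r : ℕ} (P : Protocol r n) (k : Fin r) :
    Causal 0 (P.relayMap k) := by
  intro i c c' h
  unfold Protocol.relayMap
  congr 1
  funext t
  exact h _ (by simp)

/-- Given the message, the received blocks form a Markov chain along the nodes, so the sum over the
table can be done node by node. -/
lemma sum_table_eq_chainExp (p : ℝ) (r : ℕ) (F : Fin r → (Fin n → Bool) → Fin n → Bool)
    (x : Fin n → Bool) (g : (Fin n → Bool) → ℝ) :
    ∑ Y : Fin (r + 1) → Fin n → Bool, (∏ i, bsc p (x i) (Y 0 i)) *
      (∏ k : Fin r, ∏ i, bsc p (F k (Y k.castSucc) i) (Y k.succ i)) * g (Y (Fin.last r))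
      = bscExp p x (chainExp p (List.ofFn F) g) := by
  induction r generalizing x with
  | zero =>
    rw [← (Equiv.funUnique (Fin 1) (Fin n → Bool)).symm.sum_comp]
    simp [bscExp, chainExp]
  | succ r ih =>
    rw [← (Fin.consEquiv fun _ : Fin (r + 2) => Fin n → Bool).sum_comp, Fintype.sum_prod_type]
    unfold bscExp
    refine Finset.sum_congr rfl fun c _ => ?_
    rw [List.ofFn_succ]
    simp only [chainExp]
    rw [← ih (fun k => F k.succ) (F 0 c), Finset.mul_sum]
    refine Finset.sum_congr rfl fun Y _ => ?_
    simp only [Fin.consEquiv, Equiv.coe_fn_mk, Fin.prod_univ_succ (n := r), Fin.castSucc_zero,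
      Fin.cons_zero, Fin.cons_succ, ← Fin.succ_last, ← Fin.succ_castSucc]
    ring

lemma Protocol.errorProb_eq {r : ℕ} (P : Protocol r n) (p : ℝ) :
    P.errorProb p =
      ∑ θ, (1 / 2 : ℝ) * condError p P.encode (List.ofFn P.relayMap) P.decode θ := by
  unfold Protocol.errorProb condError
  refine Finset.sum_congr rfl fun θ _ => ?_
  congr 1
  rw [← sum_table_eq_chainExp, ← (Equiv.piComm fun (_ : Fin n) (_ : Fin (r + 1)) => Bool).sum_comp]
  refine Finset.sum_congr rfl fun y _ => ?_
  have : P.outputProb p θ y = (∏ i, bsc p (P.encode θ i) (y i 0)) *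
      ∏ k : Fin r, ∏ i, bsc p (P.relayMap k (fun i => y i k.castSucc) i) (y i k.succ) := by
    unfold Protocol.outputProb
    rw [Finset.prod_comm, Fin.prod_univ_succ]
    rfl
  simp only [Equiv.piComm_apply, this, mul_ite, mul_one, mul_zero]
  rfl

/-- Chains of causal maps are realized by protocols. -/
lemma exists_protocol_errorProb_eq (p : ℝ) (enc : Bool → Fin n → Bool)
    (fs : List ((Fin n → Bool) → Fin n → Bool)) (hfs : ∀ f ∈ fs, Causal 0 f)
    (dec : (Fin n → Bool) → Bool) :
    ∃ P : Protocol fs.length n, P.errorProb p = ∑ θ, (1 / 2 : ℝ) * condError p enc fs dec θ := by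
  let P : Protocol fs.length n :=
    { encode := enc
      relay := fun k i h => fs.get k (fun t => if ht : (t : ℕ) < i then h ⟨t, ht⟩ else false) i
      decode := dec }
  refine ⟨P, ?_⟩
  have : P.relayMap = fs.get := by
    funext k c i
    refine hfs _ (List.get_mem fs k) i _ _ fun t ht => ?_
    rw [dif_pos (by simpa using ht)]
    rfl
  rw [P.errorProb_eq, this, List.ofFn_get]

end protocol

/-! ### Chi-squared information and its contraction -/

section converse

variable {ι κ : Type*} [Fintype ι] [Fintype κ]

/-- The (unnormalized) chi-squared information about a uniform bit in an observation that has law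
`a` or `b` depending on the bit. -/
noncomputable def chiInfo {α : Type*} [Fintype α] (a b : α → ℝ) : ℝ :=
  ∑ h, (a h - b h) ^ 2 / (a h + b h)

/-- Disposes of zero denominators: nonnegative numbers with sum zero both vanish, so the convention
`x / 0 = 0` does no harm. -/
lemma sq_sub_eq_div_mul {a b : ℝ} (ha : 0 ≤ a) (hb : 0 ≤ b) :
    (a - b) ^ 2 = (a - b) ^ 2 / (a + b) * (a + b) := by
  rcases (add_nonneg ha hb).eq_or_lt with h | h
  · obtain rfl : a = 0 := by linarith
    obtain rfl : b = 0 := by linarith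
    simp
  · field_simp

lemma sq_sub_div_add_le {a b : ℝ} (ha : 0 ≤ a) (hb : 0 ≤ b) :
    (a - b) ^ 2 / (a + b) ≤ a + b :=
  div_le_of_le_mul₀ (by positivity) (by positivity) (by nlinarith [mul_nonneg ha hb])

lemma chiInfo_le_sum {α : Type*} [Fintype α] {a b : α → ℝ} (ha : ∀ h, 0 ≤ a h)
    (hb : ∀ h, 0 ≤ b h) : chiInfo a b ≤ ∑ h, a h + ∑ h, b h := by
  rw [← Finset.sum_add_distrib]
  exact Finset.sum_le_sum fun h _ => sq_sub_div_add_le (ha h) (hb h)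

/-- Data processing: mixing with nonnegative weights does not increase `(a - b)² / (a + b)`. -/
lemma sq_sub_div_add_sum_le {α : Type*} [Fintype α] {a b w : α → ℝ} (ha : ∀ h, 0 ≤ a h)
    (hb : ∀ h, 0 ≤ b h) (hw : ∀ h, 0 ≤ w h) :
    (∑ h, a h * w h - ∑ h, b h * w h) ^ 2 / (∑ h, a h * w h + ∑ h, b h * w h)
      ≤ ∑ h, w h * ((a h - b h) ^ 2 / (a h + b h)) := by
  rw [← Finset.sum_add_distrib, ← Finset.sum_sub_distrib]
  have hpos : ∀ h, 0 ≤ a h * w h + b h * w h := fun h =>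
    add_nonneg (mul_nonneg (ha h) (hw h)) (mul_nonneg (hb h) (hw h))
  have hpos' : ∀ h, 0 ≤ w h * ((a h - b h) ^ 2 / (a h + b h)) := fun h =>
    mul_nonneg (hw h) (div_nonneg (sq_nonneg _) (add_nonneg (ha h) (hb h)))
  refine div_le_of_le_mul₀ (Finset.sum_nonneg fun h _ => hpos h)
    (Finset.sum_nonneg fun h _ => hpos' h) ?_
  refine Finset.sum_sq_le_sum_mul_sum_of_sq_le_mul _ (fun h _ => hpos' h) (fun h _ => hpos h) ?_
  intro h _
  refine le_of_eq ?_
  linear_combination (w h) ^ 2 * sq_sub_eq_div_mul (ha h) (hb h)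

/-- The exact defect in the convexity of `u² / A`. It splits the information in a bit into what is
left after forgetting the bit and a square that measures what the bit adds. -/
lemma sq_div_add_sq_div {u v A B : ℝ} (hA : 0 < A) (hB : 0 < B) :
    u ^ 2 / A + v ^ 2 / B = (u + v) ^ 2 / (A + B) + (u * B - v * A) ^ 2 / (A * B * (A + B)) := by
  field_simp
  ring

/-- Contraction of the chi-squared information by the factor `δ²` in a binary symmetric channel
with crossover probability `(1 - δ) / 2`. -/
lemma bsc_contraction {δ a₀ a₁ b₀ b₁ : ℝ} (h0 : 0 ≤ δ) (h1 : δ < 1) (ha₀ : 0 ≤ a₀)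
    (ha₁ : 0 ≤ a₁) (hb₀ : 0 ≤ b₀) (hb₁ : 0 ≤ b₁) {p q : ℝ} (hp : p = (1 - δ) / 2)
    (hq : q = (1 + δ) / 2) :
    ((q * a₀ + p * a₁) - (q * b₀ + p * b₁)) ^ 2 / ((q * a₀ + p * a₁) + (q * b₀ + p * b₁)) +
      ((p * a₀ + q * a₁) - (p * b₀ + q * b₁)) ^ 2 / ((p * a₀ + q * a₁) + (p * b₀ + q * b₁))
    ≤ (1 - δ ^ 2) * (((a₀ + a₁) - (b₀ + b₁)) ^ 2 / ((a₀ + a₁) + (b₀ + b₁))) +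
      δ ^ 2 * ((a₀ - b₀) ^ 2 / (a₀ + b₀) + (a₁ - b₁) ^ 2 / (a₁ + b₁)) := by
  have hp0 : 0 < p := by linarith
  have hq0 : 0 < q := by linarith
  have hpq : p + q = 1 := by linarith
  have hscale : ∀ k x y : ℝ, 0 < k →
      (k * x - k * y) ^ 2 / (k * x + k * y) = k * ((x - y) ^ 2 / (x + y)) := by
    intro k x y hk
    rw [← mul_sub, ← mul_add, mul_pow, sq k, mul_assoc, mul_div_mul_left _ _ hk.ne', mul_div_assoc]
  rcases (add_nonneg ha₀ hb₀).eq_or_lt with ht₀ | ht₀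
  · obtain rfl : a₀ = 0 := by linarith
    obtain rfl : b₀ = 0 := by linarith
    simp only [mul_zero, zero_add, hscale _ _ _ hp0, hscale _ _ _ hq0, sub_self, add_zero, div_zero]
    apply le_of_eq
    linear_combination ((a₁ - b₁) ^ 2 / (a₁ + b₁)) * hpq
  rcases (add_nonneg ha₁ hb₁).eq_or_lt with ht₁ | ht₁
  · obtain rfl : a₁ = 0 := by linarith
    obtain rfl : b₁ = 0 := by linarith
    simp only [mul_zero, add_zero, hscale _ _ _ hp0, hscale _ _ _ hq0, sub_self, div_zero]
    apply le_of_eq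
    linear_combination ((a₀ - b₀) ^ 2 / (a₀ + b₀)) * hpq
  set A := (q * a₀ + p * a₁) + (q * b₀ + p * b₁) with hA
  set B := (p * a₀ + q * a₁) + (p * b₀ + q * b₁) with hB
  have hApos : 0 < A := by
    have : A = q * (a₀ + b₀) + p * (a₁ + b₁) := by rw [hA]; ring
    rw [this]; positivity
  have hBpos : 0 < B := by
    have : B = p * (a₀ + b₀) + q * (a₁ + b₁) := by rw [hB]; ring
    rw [this]; positivity
  set t₀ := a₀ + b₀ with hht₀
  set t₁ := a₁ + b₁ with hht₁
  -- The noise evens out the masses of the two outcomes, which increases their product.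
  have hAB : t₀ * t₁ ≤ A * B := by
    have : A * B - t₀ * t₁ = p * q * (t₀ - t₁) ^ 2 := by
      rw [hA, hB, hht₀, hht₁]
      have : q = 1 - p := by linarith
      subst this; ring
    nlinarith [mul_nonneg (mul_pos hp0 hq0).le (sq_nonneg (t₀ - t₁))]
  have hsum : A + B = t₀ + t₁ := by
    rw [hA, hB, hht₀, hht₁]; linear_combination (a₀ + a₁ + b₀ + b₁) * hpq
  rw [sq_div_add_sq_div hApos hBpos, sq_div_add_sq_div ht₀ ht₁]
  have e1 : (q * a₀ + p * a₁) - (q * b₀ + p * b₁) + ((p * a₀ + q * a₁) - (p * b₀ + q * b₁))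
      = a₀ + a₁ - (b₀ + b₁) := by linear_combination (a₀ + a₁ - b₀ - b₁) * hpq
  have e2 : a₀ - b₀ + (a₁ - b₁) = a₀ + a₁ - (b₀ + b₁) := by ring
  have e3 : a₀ + a₁ + (b₀ + b₁) = t₀ + t₁ := by rw [hht₀, hht₁]; ring
  -- The defect term has its numerator scaled by exactly `δ²`; the other term is the same before and
  -- after the channel.
  have e4 : ((q * a₀ + p * a₁) - (q * b₀ + p * b₁)) * B
      - ((p * a₀ + q * a₁) - (p * b₀ + q * b₁)) * A
      = δ * ((a₀ - b₀) * t₁ - (a₁ - b₁) * t₀) := by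
    rw [hA, hB, hht₀, hht₁, hp, hq]; ring
  rw [e1, e2, e3, e4, hsum, mul_pow]
  have : (δ ^ 2 * ((a₀ - b₀) * t₁ - (a₁ - b₁) * t₀) ^ 2) / (A * B * (t₀ + t₁))
      ≤ (δ ^ 2 * ((a₀ - b₀) * t₁ - (a₁ - b₁) * t₀) ^ 2) / (t₀ * t₁ * (t₀ + t₁)) := by
    gcongr
  rw [mul_div_assoc (δ ^ 2) _ (t₀ * t₁ * (t₀ + t₁))] at this
  linarith

/-- The law of the subfamily `e` of the coordinates. -/
noncomputable def marginal [DecidableEq ι] (e : κ → ι) (a : (ι → Bool) → ℝ) (h : κ → Bool) : ℝ :=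
  ∑ c, a c * if c ∘ e = h then 1 else 0

/-- The law of the output block when a block of law `a` is processed by `f` and sent through the
binary symmetric channel. -/
noncomputable def pushLaw [DecidableEq ι] (p : ℝ) (f : (ι → Bool) → ι → Bool)
    (a : (ι → Bool) → ℝ) (y : ι → Bool) : ℝ :=
  ∑ c, a c * ∏ i, bsc p (f c i) (y i)

/-- `a` is a probability mass function. -/
def IsLaw {α : Type*} [Fintype α] (a : α → ℝ) : Prop := (∀ c, 0 ≤ a c) ∧ ∑ c, a c = 1

variable [DecidableEq ι]

lemma isLaw_pushLaw {p : ℝ} (h0 : 0 ≤ p) (h1 : p ≤ 1) (f : (ι → Bool) → ι → Bool)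
    {a : (ι → Bool) → ℝ} (ha : IsLaw a) : IsLaw (pushLaw p f a) := by
  refine ⟨fun c' => Finset.sum_nonneg fun c _ => mul_nonneg (ha.1 c) (prod_bsc_nonneg h0 h1 _ _), ?_⟩
  unfold pushLaw
  rw [Finset.sum_comm]
  simp only [← Finset.mul_sum, sum_prod_bsc, mul_one, ha.2]

lemma isLaw_marginal (e : κ → ι) {a : (ι → Bool) → ℝ} (ha : IsLaw a) [DecidableEq κ] :
    IsLaw (marginal e a) := by
  refine ⟨fun h => Finset.sum_nonneg fun c _ => mul_nonneg (ha.1 c) (by split_ifs <;> norm_num), ?_⟩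
  unfold marginal
  rw [Finset.sum_comm]
  simp [ha.2]

lemma sum_mul_comp_eq_sum_marginal [DecidableEq κ] (e : κ → ι) (a : (ι → Bool) → ℝ)
    (g : (κ → Bool) → ℝ) : ∑ c, a c * g (c ∘ e) = ∑ h, marginal e a h * g h := by
  simp only [marginal, Finset.sum_mul]
  rw [Finset.sum_comm]
  refine Finset.sum_congr rfl fun c _ => ?_
  simp

lemma marginal_pushLaw (p : ℝ) (e : κ → ι) (he : Function.Injective e)
    (f : (ι → Bool) → ι → Bool) (a : (ι → Bool) → ℝ) (h : κ → Bool) :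
    marginal e (pushLaw p f a) h = ∑ c, a c * ∏ k, bsc p (f c (e k)) (h k) := by
  simp only [marginal, pushLaw, Finset.sum_mul]
  rw [Finset.sum_comm]
  refine Finset.sum_congr rfl fun c _ => ?_
  rw [← sum_prod_bsc_comp_eq p e he (f c) h, Finset.mul_sum]
  exact Finset.sum_congr rfl fun _ _ => by ring

lemma sum_pushLaw_mul (p : ℝ) (f : (ι → Bool) → ι → Bool) (a g : (ι → Bool) → ℝ) :
    ∑ c, pushLaw p f a c * g c = ∑ c, a c * bscExp p (f c) g := by
  simp only [pushLaw, bscExp, Finset.sum_mul, Finset.mul_sum]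
  rw [Finset.sum_comm]
  exact Finset.sum_congr rfl fun _ _ => Finset.sum_congr rfl fun _ _ => by ring

end converse

/-! ### Information recursion along the chain and the converse bound -/

section recursion

variable {n : ℕ}

/-- Apply the channel contraction separately for each received prefix. The prefix alone carries the
first term; the prefix together with the next sent bit is, by causality, a randomized function of
the first `i` input bits, so data processing bounds its information by the second. -/
lemma chiInfo_pushLaw_succ_le {δ : ℝ} (h0 : 0 ≤ δ) (h1 : δ < 1)
    {f : (Fin n → Bool) → Fin n → Bool} (hf : Causal 0 f) {a b : (Fin n → Bool) → ℝ}
    (ha : IsLaw a) (hb : IsLaw b) {i : ℕ} (hi : i + 1 ≤ n) (hi' : i ≤ n) :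
    chiInfo (marginal (Fin.castLE hi) (pushLaw ((1 - δ) / 2) f a))
        (marginal (Fin.castLE hi) (pushLaw ((1 - δ) / 2) f b))
      ≤ (1 - δ ^ 2) * chiInfo (marginal (Fin.castLE hi') (pushLaw ((1 - δ) / 2) f a))
          (marginal (Fin.castLE hi') (pushLaw ((1 - δ) / 2) f b))
        + δ ^ 2 * chiInfo (marginal (Fin.castLE hi') a) (marginal (Fin.castLE hi') b) := by
  set p := (1 - δ) / 2 with hp
  have hp0 : 0 ≤ p := by linarith
  have hp1 : p ≤ 1 := by linarith
  let e : Fin i → Fin n := Fin.castLE hi'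
  have he : Function.Injective e := Fin.castLE_injective hi'
  let j : Fin n := ⟨i, hi⟩
  -- joint weight of a received prefix and the next sent bit, given the input block
  let w : (Fin n → Bool) → (Fin i → Bool) → Bool → ℝ := fun c h' x =>
    (∏ k, bsc p (f c (e k)) (h' k)) * if f c j = x then 1 else 0
  -- The padding value `false` is immaterial: up to time `i` the map `f` does not look at these
  -- positions.
  let ext : (Fin i → Bool) → Fin n → Bool := fun h t =>
    if ht : (t : ℕ) < i then h ⟨t, ht⟩ else false
  have hw : ∀ c h' x, 0 ≤ w c h' x := fun c h' x =>
    mul_nonneg (prod_bsc_nonneg hp0 hp1 _ _) (by split_ifs <;> norm_num)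
  have hwext : ∀ c, w c = w (ext (c ∘ e)) := by
    intro c
    have hfe : ∀ t : Fin n, (t : ℕ) ≤ i → f c t = f (ext (c ∘ e)) t := by
      intro t ht
      refine hf t _ _ fun k hk => ?_
      have hki : (k : ℕ) < i := by omega
      simp only [ext, hki, dif_pos, Function.comp_apply]
      rfl
    funext h' x
    simp only [w]
    rw [hfe j le_rfl]
    congr 1
    exact Finset.prod_congr rfl fun k _ => by rw [hfe (e k) k.2.le]
  let A : ((Fin n → Bool) → ℝ) → (Fin i → Bool) → Bool → ℝ := fun a h' x => ∑ c, a c * w c h' x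
  have hA : ∀ a h' x, A a h' x = ∑ h, marginal e a h * w (ext h) h' x := by
    intro a h' x
    rw [← sum_mul_comp_eq_sum_marginal e a fun h => w (ext h) h' x]
    exact Finset.sum_congr rfl fun c _ => by rw [hwext c]
  have hA0 : ∀ {a : (Fin n → Bool) → ℝ}, IsLaw a → ∀ h' x, 0 ≤ A a h' x := fun ha h' x =>
    Finset.sum_nonneg fun c _ => mul_nonneg (ha.1 c) (hw _ _ _)
  have hm : ∀ a h', marginal e (pushLaw p f a) h' = A a h' false + A a h' true := by
    intro a h'
    rw [marginal_pushLaw p e he]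
    simp only [A, ← Finset.sum_add_distrib, w]
    refine Finset.sum_congr rfl fun c _ => ?_
    cases f c j <;> simp
  have hm' : ∀ a h' z, marginal (Fin.castLE hi) (pushLaw p f a) (Fin.snoc h' z)
      = A a h' false * bsc p false z + A a h' true * bsc p true z := by
    intro a h' z
    rw [marginal_pushLaw p _ (Fin.castLE_injective hi)]
    simp only [A, Finset.sum_mul, ← Finset.sum_add_distrib, w]
    refine Finset.sum_congr rfl fun c _ => ?_
    rw [Fin.prod_univ_castSucc]
    simp only [Fin.snoc_castSucc, Fin.snoc_last]
    have : Fin.castLE hi (Fin.last i) = j := rfl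
    rw [this]
    have : ∀ k : Fin i, Fin.castLE hi k.castSucc = e k := fun _ => rfl
    simp only [this]
    cases f c j <;> simp <;> ring
  have hstep : chiInfo (marginal (Fin.castLE hi) (pushLaw p f a))
      (marginal (Fin.castLE hi) (pushLaw p f b))
      ≤ ∑ h', ((1 - δ ^ 2) * (((A a h' false + A a h' true) - (A b h' false + A b h' true)) ^ 2 /
          ((A a h' false + A a h' true) + (A b h' false + A b h' true))) +
        δ ^ 2 * ∑ x, (A a h' x - A b h' x) ^ 2 / (A a h' x + A b h' x)) := by
    unfold chiInfo
    rw [← (Fin.snocEquiv fun _ : Fin (i + 1) => Bool).sum_comp, Fintype.sum_prod_type_right]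
    refine Finset.sum_le_sum fun h' _ => ?_
    have hc := bsc_contraction h0 h1 (hA0 ha h' false) (hA0 ha h' true) (hA0 hb h' false)
      (hA0 hb h' true) hp (q := 1 - p) (by rw [hp]; ring)
    have hs : ∀ z, (Fin.snocEquiv fun _ : Fin (i + 1) => Bool) (z, h') = Fin.snoc h' z :=
      fun _ => rfl
    simp only [hs, hm', Fintype.sum_bool, bsc, if_true, reduceCtorEq, if_false]
    rw [add_comm] at hc
    refine le_trans (le_of_eq ?_) (hc.trans (le_of_eq ?_))
    · simp only [mul_comm]
    · rw [add_comm ((A a h' false - _) ^ 2 / _)]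
  refine hstep.trans ?_
  rw [Finset.sum_add_distrib, ← Finset.mul_sum, ← Finset.mul_sum]
  have e1 : chiInfo (marginal e (pushLaw p f a)) (marginal e (pushLaw p f b))
      = ∑ h', (((A a h' false + A a h' true) - (A b h' false + A b h' true)) ^ 2 /
          ((A a h' false + A a h' true) + (A b h' false + A b h' true))) := by
    simp only [chiInfo, hm]
  have e2 : ∑ h', ∑ x, (A a h' x - A b h' x) ^ 2 / (A a h' x + A b h' x)
      ≤ chiInfo (marginal e a) (marginal e b) := by
    calc ∑ h', ∑ x, (A a h' x - A b h' x) ^ 2 / (A a h' x + A b h' x)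
        ≤ ∑ h', ∑ x, ∑ h, w (ext h) h' x *
          ((marginal e a h - marginal e b h) ^ 2 / (marginal e a h + marginal e b h)) := by
          refine Finset.sum_le_sum fun h' _ => Finset.sum_le_sum fun x _ => ?_
          rw [hA a, hA b]
          exact sq_sub_div_add_sum_le (isLaw_marginal e ha).1 (isLaw_marginal e hb).1
            fun h => hw _ _ _
      _ = ∑ h, (∑ h', ∑ x, w (ext h) h' x) *
          ((marginal e a h - marginal e b h) ^ 2 / (marginal e a h + marginal e b h)) := by
          simp only [Finset.sum_mul]
          rw [Finset.sum_comm]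
          simp only [Finset.sum_comm (s := (Finset.univ : Finset Bool))
            (t := (Finset.univ : Finset (Fin i → Bool)))]
          rw [Finset.sum_comm]
      _ = chiInfo (marginal e a) (marginal e b) := by
          unfold chiInfo
          refine Finset.sum_congr rfl fun h _ => ?_
          have : ∑ h', ∑ x, w (ext h) h' x = 1 := by
            simp only [w, ← Finset.mul_sum, Finset.sum_ite_eq, Finset.mem_univ, if_true, mul_one]
            exact sum_prod_bsc p fun k => f (ext h) (e k)
          rw [this, one_mul]
  have := mul_le_mul_of_nonneg_left e2 (sq_nonneg δ)
  change _ ≤ (1 - δ ^ 2) * chiInfo (marginal e (pushLaw p f a)) (marginal e (pushLaw p f b))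
    + δ ^ 2 * chiInfo (marginal e a) (marginal e b)
  rw [e1]
  linarith

lemma marginal_castLE_zero {a : (Fin n → Bool) → ℝ} (ha : IsLaw a) (h : Fin 0 → Bool) :
    marginal (Fin.castLE (Nat.zero_le n)) a h = 1 := by
  unfold marginal
  refine Eq.trans (Finset.sum_congr rfl fun c _ => ?_) ha.2
  rw [if_pos (Subsingleton.elim _ _), mul_one]

/-- The geometric profile is chosen to fit the recursion: `(1-δ²)·B/2 + δ²·B = (B/2)(1+δ²)`. The
induction on `i` starts from the empty prefix, which carries no information. -/
lemma chiInfo_pushLaw_le {δ : ℝ} (h0 : 0 ≤ δ) (h1 : δ < 1)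
    {f : (Fin n → Bool) → Fin n → Bool} (hf : Causal 0 f) {a b : (Fin n → Bool) → ℝ}
    (ha : IsLaw a) (hb : IsLaw b) {B : ℝ} (hB : 0 ≤ B)
    (h : ∀ i (hi : i ≤ n), chiInfo (marginal (Fin.castLE hi) a) (marginal (Fin.castLE hi) b)
      ≤ B * (1 + δ ^ 2) ^ i) (i : ℕ) (hi : i ≤ n) :
    chiInfo (marginal (Fin.castLE hi) (pushLaw ((1 - δ) / 2) f a))
      (marginal (Fin.castLE hi) (pushLaw ((1 - δ) / 2) f b)) ≤ B / 2 * (1 + δ ^ 2) ^ i := by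
  have hp0 : 0 ≤ (1 - δ) / 2 := by linarith
  have hp1 : (1 - δ) / 2 ≤ 1 := by linarith
  induction i with
  | zero =>
    simp only [chiInfo, marginal_castLE_zero (isLaw_pushLaw hp0 hp1 f ha),
      marginal_castLE_zero (isLaw_pushLaw hp0 hp1 f hb)]
    simp
    positivity
  | succ i ih =>
    have hi' : i ≤ n := by omega
    refine (chiInfo_pushLaw_succ_le h0 h1 hf ha hb hi hi').trans ?_
    have hδ : 0 ≤ 1 - δ ^ 2 := by nlinarith
    have e1 := mul_le_mul_of_nonneg_left (ih hi') hδ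
    have e2 := mul_le_mul_of_nonneg_left (h i hi') (sq_nonneg δ)
    rw [pow_succ (1 + δ ^ 2) i]
    linarith

lemma exists_law_of_chain {δ : ℝ} (h0 : 0 ≤ δ) (h1 : δ < 1)
    (fs : List ((Fin n → Bool) → Fin n → Bool)) (hfs : ∀ f ∈ fs, Causal 0 f)
    {a b : (Fin n → Bool) → ℝ} (ha : IsLaw a) (hb : IsLaw b) {B : ℝ} (hB : 0 ≤ B)
    (h : ∀ i (hi : i ≤ n), chiInfo (marginal (Fin.castLE hi) a) (marginal (Fin.castLE hi) b)
      ≤ B * (1 + δ ^ 2) ^ i) :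
    ∃ a' b' : (Fin n → Bool) → ℝ, IsLaw a' ∧ IsLaw b' ∧
      chiInfo a' b' ≤ B / 2 ^ fs.length * (1 + δ ^ 2) ^ n ∧
      (∀ g, ∑ c, a c * chainExp ((1 - δ) / 2) fs g c = ∑ c, a' c * g c) ∧
      (∀ g, ∑ c, b c * chainExp ((1 - δ) / 2) fs g c = ∑ c, b' c * g c) := by
  induction fs generalizing a b B with
  | nil =>
    refine ⟨a, b, ha, hb, ?_, fun g => rfl, fun g => rfl⟩
    have hm : ∀ a : (Fin n → Bool) → ℝ, marginal (Fin.castLE le_rfl) a = a := by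
      intro a
      funext h
      simp [marginal]
    have := h n le_rfl
    rw [hm, hm] at this
    simpa using this
  | cons f fs ih =>
    have hp0 : 0 ≤ (1 - δ) / 2 := by linarith
    have hp1 : (1 - δ) / 2 ≤ 1 := by linarith
    obtain ⟨a', b', ha', hb', hc, hga, hgb⟩ := ih (fun g hg => hfs g (by simp [hg]))
      (isLaw_pushLaw hp0 hp1 f ha) (isLaw_pushLaw hp0 hp1 f hb) (B := B / 2) (by positivity)
      (chiInfo_pushLaw_le h0 h1 (hfs f (by simp)) ha hb hB h)
    refine ⟨a', b', ha', hb', ?_, fun g => ?_, fun g => ?_⟩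
    · rwa [List.length_cons, pow_succ', ← div_div]
    · rw [← hga, sum_pushLaw_mul]; rfl
    · rw [← hgb, sum_pushLaw_mul]; rfl

/-- Cauchy-Schwarz for the difference of the two laws tested against the `±1`-valued decision, with
weights `a + b` of total mass 2. -/
lemma sq_error_gap_le {α : Type*} [Fintype α] {a b : α → ℝ} (ha : IsLaw a) (hb : IsLaw b)
    (dec : α → Bool) :
    (1 - (∑ c, a c * (if dec c ≠ false then 1 else 0) + ∑ c, b c * (if dec c ≠ true then 1 else 0)))
      ^ 2 ≤ chiInfo a b / 2 := by
  let σ : α → ℝ := fun c => if dec c = false then 1 else -1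
  have key : ∑ c, (a c - b c) * σ c = 2 * (1 - (∑ c, a c * (if dec c ≠ false then 1 else 0) +
      ∑ c, b c * (if dec c ≠ true then 1 else 0))) := by
    have e1 : ∑ c, (a c - b c) * σ c = ∑ c, a c + ∑ c, b c
      - 2 * (∑ c, a c * (if dec c ≠ false then 1 else 0) +
      ∑ c, b c * (if dec c ≠ true then 1 else 0)) := by
      simp only [← Finset.sum_add_distrib, Finset.mul_sum, ← Finset.sum_sub_distrib, σ]
      refine Finset.sum_congr rfl fun c _ => ?_
      cases dec c <;> simp <;> ring
    rw [e1, ha.2, hb.2]; ring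
  have cs := Finset.sum_sq_le_sum_mul_sum_of_sq_le_mul Finset.univ
    (r := fun c => (a c - b c) * σ c) (f := fun c => (a c - b c) ^ 2 / (a c + b c))
    (g := fun c => a c + b c)
    (fun c _ => div_nonneg (sq_nonneg _) (add_nonneg (ha.1 c) (hb.1 c)))
    (fun c _ => add_nonneg (ha.1 c) (hb.1 c)) (fun c _ => by
      have hσ : σ c ^ 2 = 1 := by simp only [σ]; split_ifs <;> norm_num
      rw [mul_pow, hσ, mul_one]
      exact (sq_sub_eq_div_mul (ha.1 c) (hb.1 c)).le)
  rw [key, Finset.sum_add_distrib, ha.2, hb.2] at cs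
  change _ ≤ chiInfo a b * _ at cs
  linarith

lemma Protocol.sq_error_gap_le {r : ℕ} (P : Protocol r n) {δ : ℝ} (h0 : 0 ≤ δ) (h1 : δ < 1) :
    (1 - 2 * P.errorProb ((1 - δ) / 2)) ^ 2 ≤ (1 + δ ^ 2) ^ n / 2 ^ r := by
  set p := (1 - δ) / 2 with hp
  have hp0 : 0 ≤ p := by linarith
  have hp1 : p ≤ 1 := by linarith
  have hlaw : ∀ θ, IsLaw fun c : Fin n → Bool => ∏ i, bsc p (P.encode θ i) (c i) := fun θ =>
    ⟨fun c => prod_bsc_nonneg hp0 hp1 _ _, sum_prod_bsc p _⟩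
  -- The starting constant 2 is the total mass of the two laws; no contraction is claimed for the
  -- first hop.
  obtain ⟨a, b, ha, hb, hc, hga, hgb⟩ := exists_law_of_chain h0 h1 (List.ofFn P.relayMap)
    (by simp only [List.mem_ofFn]; rintro _ ⟨k, rfl⟩; exact P.relayMap_causal k)
    (hlaw false) (hlaw true) (B := 2) (by norm_num) (by
      intro i hi
      refine (chiInfo_le_sum (isLaw_marginal _ (hlaw _)).1 (isLaw_marginal _ (hlaw _)).1).trans ?_
      rw [(isLaw_marginal _ (hlaw _)).2, (isLaw_marginal _ (hlaw _)).2]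
      have : 1 ≤ (1 + δ ^ 2) ^ i := one_le_pow₀ (by nlinarith)
      linarith)
  have herr : 1 - 2 * P.errorProb p = 1 - (∑ c, a c * (if P.decode c ≠ false then 1 else 0) +
      ∑ c, b c * (if P.decode c ≠ true then 1 else 0)) := by
    rw [P.errorProb_eq, ← hga, ← hgb, Fintype.sum_bool]
    simp only [condError, bscExp]
    ring
  rw [herr]
  refine (BitRelay.sq_error_gap_le ha hb P.decode).trans ?_
  rw [List.length_ofFn] at hc
  calc chiInfo a b / 2 ≤ 2 / 2 ^ r * (1 + δ ^ 2) ^ n / 2 := by gcongr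
    _ = _ := by ring

/-- The block length is at least of order `r / δ²` if the error probability stays below `1 / 2`. -/
lemma exists_forall_hops_le {ε : ℝ} (hε : ε < 1 / 2) : ∃ R : ℕ, ∀ δ : ℝ, 0 ≤ δ → δ < 1 →
    ∀ r, R ≤ r → ∀ (n : ℕ) (P : Protocol r n), P.errorProb ((1 - δ) / 2) ≤ ε →
      ((r + 1 : ℕ) : ℝ) ≤ 2 * δ ^ 2 * n := by
  have hε' : 0 < 1 - 2 * ε := by linarith
  -- Taking logarithms will give `r log 2 + 2 log (1 - 2ε) ≤ n δ²`. Since `log 2 > 1/2`, for `r ≥ R`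
  -- the surplus `r (log 2 - 1/2)` pays for the constants, and `R` does not depend on `δ`.
  obtain ⟨R, hR⟩ := exists_nat_ge ((1 / 2 - 2 * Real.log (1 - 2 * ε)) / (Real.log 2 - 1 / 2))
  refine ⟨R, fun δ h0 h1 r hr n P hP => ?_⟩
  have hlog : 0 < Real.log 2 - 1 / 2 := by have := Real.log_two_gt_d9; linarith
  have hgap := P.sq_error_gap_le h0 h1
  have h2 : (1 - 2 * ε) ^ 2 * 2 ^ r ≤ (1 + δ ^ 2) ^ n := by
    rw [le_div_iff₀ (by positivity)] at hgap
    refine le_trans ?_ hgap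
    gcongr
  have h3 := Real.log_le_log (by positivity) h2
  rw [Real.log_mul (by positivity) (by positivity), Real.log_pow, Real.log_pow, Real.log_pow] at h3
  have h4 : (n : ℝ) * Real.log (1 + δ ^ 2) ≤ n * δ ^ 2 := by
    gcongr
    have := Real.log_le_sub_one_of_pos (x := 1 + δ ^ 2) (by positivity)
    linarith
  have h5 := hR.trans (Nat.cast_le (α := ℝ).2 hr)
  rw [div_le_iff₀ hlog] at h5
  push_cast at h3 ⊢
  linarith

end recursion

/-! ### Building blocks for relaying schemes -/

section schemes

/-- There is a chain with `r` relays in which every node uses `τ` consecutive channel uses, where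
the nodes start their transmissions with successive delays of total length `D`, and the error
probability is at most `ε` for both messages. -/
def Achieves (p : ℝ) (r D τ : ℕ) (ε : ℝ) : Prop :=
  ∃ (enc : Bool → Fin τ → Bool) (L : List (ℕ × ((Fin τ → Bool) → Fin τ → Bool)))
    (dec : (Fin τ → Bool) → Bool), L.length = r ∧ (L.map Prod.fst).sum = D ∧
    (∀ x ∈ L, Causal x.1 x.2) ∧ ∀ θ, condError p enc (L.map Prod.snd) dec θ ≤ ε

variable {p : ℝ}

lemma Achieves.mono {r D τ : ℕ} {ε ε' : ℝ} (h : Achieves p r D τ ε) (hε : ε ≤ ε') :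
    Achieves p r D τ ε' := by
  obtain ⟨enc, L, dec, h1, h2, h3, h4⟩ := h
  exact ⟨enc, L, dec, h1, h2, h3, fun θ => (h4 θ).trans hε⟩

lemma Achieves.nonneg {r D τ : ℕ} {ε : ℝ} (h0 : 0 ≤ p) (h1 : p ≤ 1) (h : Achieves p r D τ ε) :
    0 ≤ ε := by
  obtain ⟨enc, L, dec, -, -, -, h4⟩ := h
  exact (condError_nonneg h0 h1 _ _ _ true).trans (h4 true)

/-- A single channel use over one hop. -/
lemma achieves_single (p : ℝ) : Achieves p 0 0 1 p := by
  refine ⟨fun θ _ => θ, [], fun c => c 0, rfl, rfl, by simp, fun θ => le_of_eq ?_⟩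
  simp only [condError, chainExp, bscExp, List.map_nil]
  rw [← (Equiv.funUnique (Fin 1) Bool).symm.sum_comp]
  cases θ <;> simp [bsc]

/-- Concatenation of two chains; the node in between decodes and re-encodes. -/
lemma Achieves.concat {r r' D D' τ : ℕ} {ε ε' : ℝ} (h0 : 0 ≤ p) (h1 : p ≤ 1)
    (h : Achieves p r D τ ε) (h' : Achieves p r' D' τ ε') :
    Achieves p (r + 1 + r') (D + τ + D') τ (ε + ε') := by
  have hε' := h'.nonneg h0 h1
  obtain ⟨enc, L, dec, hr, hD, hL, he⟩ := h
  obtain ⟨enc', L', dec', hr', hD', hL', he'⟩ := h'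
  -- The joining node must receive its whole window before it re-encodes, hence its delay `τ`.
  refine ⟨enc, L ++ (τ, fun c => enc' (dec c)) :: L', dec', by simp; omega, by simp; omega, ?_,
    fun θ => ?_⟩
  · simp only [List.mem_append, List.mem_cons]
    rintro x (hx | rfl | hx)
    · exact hL x hx
    · intro i c c' hc
      have : c = c' := funext fun k => hc k (by dsimp only; omega)
      rw [this]
    · exact hL' x hx
  · simp only [condError, List.map_append, List.map_cons, chainExp_append, chainExp]
    have hle : ∀ b, bscExp p (enc' b) (chainExp p (L'.map Prod.snd)
        fun c => if dec' c ≠ θ then 1 else 0) ≤ (if b ≠ θ then 1 else 0) + ε' := by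
      intro b
      by_cases hb : b = θ
      · rw [hb, if_neg (by simp), zero_add]
        exact he' θ
      · rw [if_pos hb]
        have : bscExp p (enc' b) (chainExp p (L'.map Prod.snd)
            fun c => if dec' c ≠ θ then 1 else 0) ≤ 1 := by
          calc _ ≤ bscExp p (enc' b) (chainExp p (L'.map Prod.snd) fun _ => 1) :=
                bscExp_mono h0 h1 _ (chainExp_mono h0 h1 _ fun c => by split_ifs <;> norm_num)
            _ = 1 := by rw [chainExp_const, bscExp_const]
        linarith
    calc _ ≤ bscExp p (enc θ) (chainExp p (L.map Prod.snd)
          fun c => (if dec c ≠ θ then 1 else 0) + ε') :=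
          bscExp_mono h0 h1 _ (chainExp_mono h0 h1 _ fun c => hle (dec c))
      _ = condError p enc (L.map Prod.snd) dec θ + ε' := by
          rw [chainExp_add, bscExp_add, chainExp_const, bscExp_const]; rfl
      _ ≤ ε + ε' := by linarith [he θ]

/-- A block of length `R * τ` as `R` successive blocks of length `τ`. -/
def blockEquiv (R τ : ℕ) : (Fin (R * τ) → Bool) ≃ (Fin R → Fin τ → Bool) :=
  (Equiv.arrowCongr finProdFinEquiv (Equiv.refl Bool)).symm.trans (Equiv.curry _ _ _)

/-- Apply `f` to each of `R` successive blocks. -/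
def blockMap (R : ℕ) {τ : ℕ} (f : (Fin τ → Bool) → Fin τ → Bool) (c : Fin (R * τ) → Bool) :
    Fin (R * τ) → Bool :=
  (blockEquiv R τ).symm fun u => f (blockEquiv R τ c u)

lemma blockEquiv_apply {R τ : ℕ} (c : Fin (R * τ) → Bool) (u : Fin R) (i : Fin τ) :
    blockEquiv R τ c u i = c (finProdFinEquiv (u, i)) := rfl

lemma blockEquiv_symm_apply {R τ : ℕ} (X : Fin R → Fin τ → Bool) (u : Fin R) (i : Fin τ) :
    (blockEquiv R τ).symm X (finProdFinEquiv (u, i)) = X u i := by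
  rw [← blockEquiv_apply ((blockEquiv R τ).symm X), Equiv.apply_symm_apply]

/-- Repetition does not increase the delay: each block is computed from the corresponding received
block alone, so the offset stays below `d`. -/
lemma Causal.blockMap {R τ d : ℕ} {f : (Fin τ → Bool) → Fin τ → Bool} (hf : Causal d f) :
    Causal d (blockMap R f) := by
  intro t c c' h
  obtain ⟨⟨u, i⟩, rfl⟩ := finProdFinEquiv.surjective t
  simp only [BitRelay.blockMap, blockEquiv_symm_apply]
  refine hf i _ _ fun k hk => h _ ?_
  simp only [finProdFinEquiv_apply_val]
  omega

lemma bscExp_blockEquiv_symm (p : ℝ) {R τ : ℕ} (X : Fin R → Fin τ → Bool)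
    (g : (Fin τ → Bool) → ℝ) :
    bscExp p ((blockEquiv R τ).symm X) (fun c => ∏ u, g (blockEquiv R τ c u))
      = ∏ u, bscExp p (X u) g := by
  unfold bscExp
  rw [← (blockEquiv R τ).symm.sum_comp, Finset.prod_univ_sum, Fintype.piFinset_univ]
  refine Finset.sum_congr rfl fun Y _ => ?_
  simp only [Equiv.apply_symm_apply]
  rw [← finProdFinEquiv.prod_comp, Fintype.prod_prod_type, Finset.prod_mul_distrib]
  simp only [blockEquiv_symm_apply]

lemma chainExp_blockMap (p : ℝ) {R τ : ℕ} (fs : List ((Fin τ → Bool) → Fin τ → Bool))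
    (g : (Fin τ → Bool) → ℝ) :
    chainExp p (fs.map (blockMap R)) (fun c => ∏ u, g (blockEquiv R τ c u))
      = fun c => ∏ u, chainExp p fs g (blockEquiv R τ c u) := by
  induction fs with
  | nil => rfl
  | cons f fs ih =>
    funext c
    simp only [List.map_cons, chainExp, ih]
    exact bscExp_blockEquiv_symm p (fun u => f (blockEquiv R τ c u)) (chainExp p fs g)

/-- The majority of `R` bits; `false` in case of a tie. -/
def majority {R : ℕ} (v : Fin R → Bool) : Bool :=
  decide (R < 2 * (Finset.univ.filter fun u => v u = true).card)

/-- Exponential Markov bound: when the vote is wrong, wrong bits are at least as many as right ones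
(ties included), so the product is at least 1. -/
lemma majority_ne_le_prod {R : ℕ} (v : Fin R → Bool) (θ : Bool) {x : ℝ} (hx : 1 ≤ x) :
    (if majority v ≠ θ then 1 else 0 : ℝ) ≤ ∏ u, if v u ≠ θ then x else x⁻¹ := by
  have hx0 : 0 < x := by linarith
  split_ifs with h
  · rw [Finset.prod_ite, Finset.prod_const, Finset.prod_const]
    have hcard := Finset.card_filter_add_card_filter_not (s := (Finset.univ : Finset (Fin R)))
      (fun u => v u ≠ θ)
    rw [Finset.card_univ, Fintype.card_fin] at hcard
    set a := (Finset.univ.filter fun u => v u ≠ θ).card with ha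
    set b := (Finset.univ.filter fun u => ¬ v u ≠ θ).card with hb
    have hab : b ≤ a := by
      cases θ
      · simp only [majority, ne_eq, decide_eq_false_iff_not, not_not, Bool.not_eq_false] at h ha hb
        omega
      · simp only [majority, ne_eq, decide_eq_true_eq, not_lt, not_not] at h ha hb
        omega
    calc (1 : ℝ) = x ^ b * x⁻¹ ^ b := by rw [← mul_pow, mul_inv_cancel₀ hx0.ne', one_pow]
      _ ≤ x ^ a * x⁻¹ ^ b := by gcongr
  · exact Finset.prod_nonneg fun u _ => by split_ifs <;> positivity

/-- Repetition with a majority vote, with the Chernoff bound on the error probability. -/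
lemma Achieves.repeat {r D τ : ℕ} {ε : ℝ} (h0 : 0 ≤ p) (h1 : p ≤ 1) (h : Achieves p r D τ ε)
    (R : ℕ) {x : ℝ} (hx : 1 ≤ x) :
    Achieves p r D (R * τ) ((x⁻¹ + (x - x⁻¹) * ε) ^ R) := by
  obtain ⟨enc, L, dec, hr, hD, hL, he⟩ := h
  refine ⟨fun θ => (blockEquiv R τ).symm fun _ => enc θ,
    L.map fun y => (y.1, blockMap R y.2),
    fun c => majority fun u => dec (blockEquiv R τ c u), by simpa using hr, ?_, ?_, fun θ => ?_⟩
  · rw [← hD, List.map_map]; rfl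
  · intro y hy
    obtain ⟨z, hz, rfl⟩ := List.mem_map.1 hy
    exact (hL z hz).blockMap
  · have hx0 : 0 < x := by linarith
    have hxx : 0 ≤ x - x⁻¹ := by
      have := inv_le_one_of_one_le₀ hx
      linarith
    have hmap : (L.map fun y => (y.1, blockMap R y.2)).map Prod.snd
        = (L.map Prod.snd).map (blockMap R) := by
      simp only [List.map_map]; rfl
    unfold condError
    rw [hmap]
    calc _ ≤ bscExp p ((blockEquiv R τ).symm fun _ => enc θ)
          (chainExp p ((L.map Prod.snd).map (blockMap R)) fun c =>
            ∏ u, (fun c' => if dec c' ≠ θ then x else x⁻¹) (blockEquiv R τ c u)) :=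
          bscExp_mono h0 h1 _ (chainExp_mono h0 h1 _ fun c => majority_ne_le_prod _ θ hx)
      _ = (bscExp p (enc θ) (chainExp p (L.map Prod.snd)
            fun c => if dec c ≠ θ then x else x⁻¹)) ^ R := by
          rw [chainExp_blockMap p (L.map Prod.snd) fun c' => if dec c' ≠ θ then x else x⁻¹,
            bscExp_blockEquiv_symm, Finset.prod_const, Finset.card_univ,
            Fintype.card_fin]
      _ = (x⁻¹ + (x - x⁻¹) * condError p enc (L.map Prod.snd) dec θ) ^ R := by
          have : (fun c => if dec c ≠ θ then x else x⁻¹)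
              = fun c => x⁻¹ + (x - x⁻¹) * if dec c ≠ θ then 1 else 0 := by
            funext c; split_ifs <;> ring
          rw [this, chainExp_add, chainExp_const, chainExp_const_mul, bscExp_add, bscExp_const,
            bscExp_const_mul, condError]
      _ ≤ _ := by
          have := condError_nonneg h0 h1 enc (L.map Prod.snd) dec θ
          gcongr
          exact he θ

/-- A chain of delayed windows runs on a common clock. -/
lemma exists_causal_chain {τ n : ℕ} (p : ℝ) (L : List (ℕ × ((Fin τ → Bool) → Fin τ → Bool)))
    (hL : ∀ x ∈ L, Causal x.1 x.2) (s s' : ℕ) (hs' : s' = s + (L.map Prod.fst).sum)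
    (h : s + τ ≤ n) (h' : s' + τ ≤ n) :
    ∃ fs : List ((Fin n → Bool) → Fin n → Bool), fs.length = L.length ∧
      (∀ f ∈ fs, Causal 0 f) ∧ ∀ g c,
        chainExp p fs (fun c => g fun i : Fin τ => c ⟨s' + i, by omega⟩) c
          = chainExp p (L.map Prod.snd) g fun i => c ⟨s + i, by omega⟩ := by
  induction L generalizing s with
  | nil =>
    refine ⟨[], rfl, by simp, fun g c => ?_⟩
    obtain rfl : s' = s := by simpa using hs'
    rfl
  | cons x L ih =>
    obtain ⟨d, f⟩ := x
    simp only [List.map_cons, List.sum_cons] at hs'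
    obtain ⟨fs, hlen, hfs, hexp⟩ := ih (fun x hx => hL x (List.mem_cons_of_mem _ hx)) (s + d)
      (by omega) (by omega)
    have hf : Causal d f := hL (d, f) List.mem_cons_self
    -- The relay transmits in the window starting at `s + d` and is idle (sends `false`) outside it.
    -- Bit `i` of the window uses only bits received before time `s + d + i`, which is causality on
    -- the common clock.
    let F : (Fin n → Bool) → Fin n → Bool := fun c t =>
      if ht : s + d ≤ t ∧ (t : ℕ) - (s + d) < τ then
        f (fun i => c ⟨s + i, by omega⟩) ⟨t - (s + d), ht.2⟩ else false
    refine ⟨F :: fs, by simp [hlen], ?_, fun g c => ?_⟩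
    · simp only [List.mem_cons]
      rintro _ (rfl | hg)
      · intro t c c' hc
        simp only [F]
        split_ifs with ht
        · refine hf _ _ _ fun k hk => hc _ ?_
          simp only at hk ⊢
          omega
        · rfl
      · exact hfs _ hg
    · let e : Fin τ → Fin n := fun i => ⟨s + d + i, by omega⟩
      have he : Function.Injective e := fun i j hij => by
        simp only [e, Fin.mk.injEq] at hij
        exact Fin.ext (by omega)
      have hF : F c ∘ e = f fun i => c ⟨s + i, by omega⟩ := by
        funext i
        simp only [F, e, Function.comp_apply]
        rw [dif_pos ⟨by omega, by omega⟩]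
        congr 1
        exact Fin.ext (by simp)
      simp only [List.map_cons, chainExp]
      rw [← hF, ← bscExp_comp p e he]
      congr 1
      funext c'
      exact hexp g c'

lemma bsc_xor (p : ℝ) (x z : Bool) : bsc p x (xor x z) = bsc p false z := by
  cases x <;> cases z <;> simp [bsc]

/-- The first hop can be dropped: some fixed noise pattern does at least as well as the average. -/
lemma exists_encoder_drop_relay {n : ℕ} (h0 : 0 < p) (h1 : p < 1) (enc : Bool → Fin n → Bool)
    (f : (Fin n → Bool) → Fin n → Bool) (fs : List ((Fin n → Bool) → Fin n → Bool))
    (dec : (Fin n → Bool) → Bool) :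
    ∃ enc' : Bool → Fin n → Bool, ∑ θ, (1 / 2 : ℝ) * condError p enc' fs dec θ
      ≤ ∑ θ, (1 / 2 : ℝ) * condError p enc (f :: fs) dec θ := by
  -- The channel output is the input XOR a noise pattern whose law `μ` does not depend on the input,
  -- so both messages can share one frozen pattern.
  let encz : (Fin n → Bool) → Bool → Fin n → Bool := fun z θ => f fun i => xor (enc θ i) (z i)
  let μ : (Fin n → Bool) → ℝ := fun z => ∏ i, bsc p ((fun _ => false : Fin n → Bool) i) (z i)
  have hμ : ∀ z, 0 < μ z := fun z => Finset.prod_pos fun i _ => by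
    unfold bsc; split_ifs <;> linarith
  have hμ1 : ∑ z, μ z = 1 := sum_prod_bsc p _
  have hcond : ∀ θ, condError p enc (f :: fs) dec θ
      = ∑ z, μ z * condError p (encz z) fs dec θ := by
    intro θ
    have hinv : Function.Involutive fun (z : Fin n → Bool) i => xor (enc θ i) (z i) := by
      intro z; funext i; simp
    rw [condError, bscExp, ← Equiv.sum_comp (hinv.toPerm _)]
    refine Finset.sum_congr rfl fun z _ => ?_
    simp only [Function.Involutive.coe_toPerm, bsc_xor]
    rfl
  set T := ∑ θ, (1 / 2 : ℝ) * condError p enc (f :: fs) dec θ with hT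
  have hsum : ∑ z, μ z * ∑ θ, (1 / 2 : ℝ) * condError p (encz z) fs dec θ = T := by
    rw [hT]
    simp only [hcond, Finset.mul_sum]
    rw [Finset.sum_comm]
    exact Finset.sum_congr rfl fun _ _ => Finset.sum_congr rfl fun _ _ => by ring
  obtain ⟨z, -, hz⟩ := Finset.exists_le_of_sum_le (s := Finset.univ) Finset.univ_nonempty
    (f := fun z => μ z * ∑ θ, (1 / 2 : ℝ) * condError p (encz z) fs dec θ)
    (g := fun z => μ z * T) (by rw [hsum, ← Finset.sum_mul, hμ1, one_mul])
  exact ⟨encz z, le_of_mul_le_mul_left hz (hμ z)⟩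

lemma exists_encoder_drop {n : ℕ} (h0 : 0 < p) (h1 : p < 1) (enc : Bool → Fin n → Bool)
    (fs : List ((Fin n → Bool) → Fin n → Bool)) (dec : (Fin n → Bool) → Bool) (k : ℕ) :
    ∃ enc' : Bool → Fin n → Bool, ∑ θ, (1 / 2 : ℝ) * condError p enc' (fs.drop k) dec θ
      ≤ ∑ θ, (1 / 2 : ℝ) * condError p enc fs dec θ := by
  induction k generalizing enc fs with
  | zero => exact ⟨enc, le_rfl⟩
  | succ k ih =>
    cases fs with
    | nil => exact ⟨enc, le_rfl⟩
    | cons f fs =>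
      obtain ⟨enc₁, h₁⟩ := exists_encoder_drop_relay h0 h1 enc f fs dec
      obtain ⟨enc₂, h₂⟩ := ih enc₁ fs
      exact ⟨enc₂, h₂.trans h₁⟩

/-- The last window starts at time `D` and lasts `τ`. Surplus hops are dropped from the front, so
schemes built only for special lengths serve all shorter chains. -/
lemma Achieves.exists_protocol {r D τ : ℕ} {ε : ℝ} (h0 : 0 < p) (h1 : p < 1)
    (h : Achieves p r D τ ε) {r' : ℕ} (hr' : r' ≤ r) :
    ∃ P : Protocol r' (D + τ), P.errorProb p ≤ ε := by
  obtain ⟨enc, L, dec, hr, hD, hL, he⟩ := h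
  obtain ⟨fs, hlen, hfs, hexp⟩ := exists_causal_chain (n := D + τ) p L hL 0 D (by omega)
    (by omega) le_rfl
  let enc₁ : Bool → Fin (D + τ) → Bool := fun θ t => if ht : (t : ℕ) < τ then enc θ ⟨t, ht⟩ else false
  let dec₁ : (Fin (D + τ) → Bool) → Bool := fun c => dec fun i => c ⟨D + i, by omega⟩
  have hcond : ∀ θ, condError p enc₁ fs dec₁ θ = condError p enc (L.map Prod.snd) dec θ := by
    intro θ
    let e : Fin τ → Fin (D + τ) := fun i => ⟨0 + i, by omega⟩
    have he : Function.Injective e := fun i j hij => by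
      simp only [e, Fin.mk.injEq] at hij
      exact Fin.ext (by omega)
    have henc : enc₁ θ ∘ e = enc θ := by
      funext i
      simp [enc₁, e]
    unfold condError
    rw [← henc, ← bscExp_comp p e he]
    congr 1
    funext c
    exact hexp (fun c => if dec c ≠ θ then 1 else 0) c
  obtain ⟨enc₂, h₂⟩ := exists_encoder_drop h0 h1 enc₁ fs dec₁ (r - r')
  obtain ⟨P, hP⟩ := exists_protocol_errorProb_eq p enc₂ (fs.drop (r - r'))
    (fun f hf => hfs f (List.mem_of_mem_drop hf)) dec₁
  have hl : (fs.drop (r - r')).length = r' := by rw [List.length_drop]; omega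
  have hle : P.errorProb p ≤ ε := by
    rw [hP]
    refine h₂.trans ?_
    simp only [hcond, Fintype.sum_bool]
    linarith [he true, he false]
  clear_value enc₁ dec₁
  clear hP
  revert P
  rw [hl]
  exact fun P hP => ⟨P, hP⟩

end schemes

/-! ### The recursive scheme with linear delay -/

section highNoise

variable {p : ℝ}

/-- Threefold repetition followed by concatenation of four copies. -/
lemma Achieves.amplify {r D τ : ℕ} {ε : ℝ} (h0 : 0 ≤ p) (h1 : p ≤ 1) (h : Achieves p r D τ ε)
    (hε0 : 0 < ε) (hε : ε ≤ 1 / 16384) :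
    Achieves p (4 * r + 3) (4 * D + 9 * τ) (3 * τ) (ε / 4) := by
  have hs0 : 0 < √ε := Real.sqrt_pos.2 hε0
  have hsq : √ε * √ε = ε := Real.mul_self_sqrt hε0.le
  have hs : √ε ≤ 1 / 128 := Real.sqrt_le_iff.2 ⟨by norm_num, by norm_num; linarith⟩
  -- The choice `x = ε^{-1/2}` gives error at most `(2√ε)³ = 8 ε^{3/2}`. This is at most `ε/16` once
  -- `√ε ≤ 1/128`, the origin of `16384 = 128²`; four copies then total `ε/4`.
  have h3 := h.repeat h0 h1 3 (x := (√ε)⁻¹) ((one_le_inv₀ hs0).2 (by linarith))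
  have hle : ((√ε)⁻¹⁻¹ + ((√ε)⁻¹ - (√ε)⁻¹⁻¹) * ε) ^ 3 ≤ ε / 16 := by
    have e1 : (√ε)⁻¹⁻¹ + ((√ε)⁻¹ - (√ε)⁻¹⁻¹) * ε = 2 * √ε - √ε * ε := by
      rw [inv_inv]
      have : (√ε)⁻¹ * ε = √ε := by
        rw [inv_mul_eq_iff_eq_mul₀ hs0.ne', hsq]
      linear_combination this
    rw [e1]
    have h2 : 0 ≤ 2 * √ε - √ε * ε := by nlinarith
    calc (2 * √ε - √ε * ε) ^ 3 ≤ (2 * √ε) ^ 3 := by gcongr; nlinarith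
      _ = 8 * √ε * ε := by linear_combination 8 * √ε * hsq
      _ ≤ ε / 16 := by nlinarith
  have h4 := h3.mono hle
  have h5 := h4.concat h0 h1 h4
  have h6 := h5.concat h0 h1 h5
  have e1 : r + 1 + r + 1 + (r + 1 + r) = 4 * r + 3 := by ring
  have e2 : D + 3 * τ + D + 3 * τ + (D + 3 * τ + D) = 4 * D + 9 * τ := by ring
  rw [e1, e2] at h6
  exact h6.mono (by linarith)

/-- With Chernoff parameter `x = 1 + δ` the base of the bound is exactly `1 - δ²/2`, so `20/δ²`
repetitions give error at most `exp (-10)`. -/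
lemma achieves_base {δ : ℝ} (h0 : 0 < δ) (h1 : δ < 1) {K : ℕ} (hK : 20 / δ ^ 2 ≤ K) :
    Achieves ((1 - δ) / 2) 0 0 K (1 / 16384) := by
  have h := (achieves_single ((1 - δ) / 2)).repeat (by linarith) (by linarith) K (x := 1 + δ)
    (by linarith)
  rw [mul_one] at h
  refine h.mono ?_
  have e1 : (1 + δ)⁻¹ + (1 + δ - (1 + δ)⁻¹) * ((1 - δ) / 2) = 1 - δ ^ 2 / 2 := by
    field_simp
    ring
  rw [e1]
  calc (1 - δ ^ 2 / 2) ^ K ≤ (Real.exp (-(δ ^ 2 / 2))) ^ K := by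
        gcongr
        · nlinarith
        · have := Real.add_one_le_exp (-(δ ^ 2 / 2)); linarith
    _ = Real.exp (-(K * δ ^ 2 / 2)) := by rw [← Real.exp_nat_mul]; congr 1; ring
    _ ≤ Real.exp (-10) := by
        rw [div_le_iff₀ (by positivity)] at hK
        gcongr
        linarith
    _ ≤ 1 / 16384 := by
        rw [Real.exp_neg, ← one_div]
        apply one_div_le_one_div_of_le (by norm_num)
        calc (16384 : ℝ) ≤ 2.7 ^ 10 := by norm_num
          _ ≤ Real.exp 1 ^ 10 := by
              gcongr
              have := Real.exp_one_gt_d9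
              linarith
          _ = Real.exp 10 := by rw [← Real.exp_nat_mul]; norm_num

/-- The quantity `D + 9τ` is multiplied by exactly 4 in each round, since `(4D + 9τ) + 9·3τ = 4 (D +
9τ)`. It dominates the block length `D + τ`. -/
lemma exists_achieves_pow {δ : ℝ} (h0 : 0 < δ) (h1 : δ < 1) {K : ℕ} (hK : 20 / δ ^ 2 ≤ K)
    (k : ℕ) : ∃ r D τ : ℕ, r + 1 = 4 ^ k ∧ τ = 3 ^ k * K ∧ D + 9 * τ = 9 * (4 ^ k * K) ∧
      Achieves ((1 - δ) / 2) r D τ (1 / 16384 / 4 ^ k) := by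
  induction k with
  | zero => exact ⟨0, 0, K, by simp, by simp, by simp, by simpa using achieves_base h0 h1 hK⟩
  | succ k ih =>
    obtain ⟨r, D, τ, hr, hτ, hD, h⟩ := ih
    refine ⟨4 * r + 3, 4 * D + 9 * τ, 3 * τ, by rw [pow_succ]; omega,
      by rw [hτ, pow_succ]; ring, ?_, ?_⟩
    · have : 4 ^ (k + 1) * K = 4 * (4 ^ k * K) := by rw [pow_succ]; ring
      omega
    · have := h.amplify (by linarith) (by linarith) (by positivity)
        (div_le_self (by norm_num) (one_le_pow₀ (by norm_num)))
      rwa [div_div, ← pow_succ] at this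

/-- Vanishing error probability is possible with block lengths of order `r / δ²`. -/
lemma exists_hasVanishingError {δ : ℝ} (h0 : 0 < δ) (h1 : δ < 1) :
    ∃ n : ℕ → ℕ, HasVanishingError ((1 - δ) / 2) n ∧
      ∀ r, (n r : ℝ) * δ ^ 2 ≤ 756 * ((r + 1 : ℕ) : ℝ) := by
  have hδ : 0 < δ ^ 2 := by positivity
  set K := ⌈20 / δ ^ 2⌉₊ with hKdef
  have hK : 20 / δ ^ 2 ≤ K := Nat.le_ceil _
  have hK' : (K : ℝ) * δ ^ 2 ≤ 21 := by
    have := (Nat.ceil_lt_add_one (show 0 ≤ 20 / δ ^ 2 by positivity)).le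
    calc (K : ℝ) * δ ^ 2 ≤ (20 / δ ^ 2 + 1) * δ ^ 2 := by gcongr
      _ = 20 + δ ^ 2 := by field_simp
      _ ≤ 21 := by nlinarith
  have key : ∀ r : ℕ, ∃ n : ℕ, (n : ℝ) * δ ^ 2 ≤ 756 * ((r + 1 : ℕ) : ℝ) ∧
      ∃ P : Protocol r n, P.errorProb ((1 - δ) / 2) ≤ 1 / ((r : ℝ) + 1) := by
    intro r
    -- The least `k` with `4^k > r + 1`; overshooting by at most a factor 4 gives `36 = 9·4`, and
    -- `756 = 36·21`.
    set k := Nat.log 4 (r + 1) + 1 with hk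
    obtain ⟨r', D, τ, hr', hτ, hD, h⟩ := exists_achieves_pow h0 h1 hK k
    have hlt : r + 1 < 4 ^ k := Nat.lt_pow_succ_log_self (by norm_num) _
    have hle : 4 ^ k ≤ 4 * (r + 1) := by
      rw [hk, pow_succ, mul_comm]
      exact Nat.mul_le_mul_left 4 (Nat.pow_log_le_self 4 (by omega))
    obtain ⟨P, hP⟩ := h.exists_protocol (by linarith) (by linarith) (r' := r) (by omega)
    refine ⟨D + τ, ?_, P, hP.trans ?_⟩
    · have hn : D + τ ≤ 9 * (4 ^ k * K) := by omega
      have hn' : D + τ ≤ 36 * (r + 1) * K :=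
        hn.trans (by calc 9 * (4 ^ k * K) ≤ 9 * (4 * (r + 1) * K) := by gcongr
          _ = _ := by ring)
      calc ((D + τ : ℕ) : ℝ) * δ ^ 2 ≤ ((36 * (r + 1) * K : ℕ) : ℝ) * δ ^ 2 := by gcongr
        _ = 36 * ((r + 1 : ℕ) : ℝ) * (K * δ ^ 2) := by push_cast; ring
        _ ≤ 36 * ((r + 1 : ℕ) : ℝ) * 21 := by gcongr
        _ = _ := by ring
    · rw [div_div]
      apply one_div_le_one_div_of_le (by positivity)
      have : ((r + 1 : ℕ) : ℝ) ≤ ((4 ^ k : ℕ) : ℝ) := Nat.cast_le.2 hlt.le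
      push_cast at this
      have h4 : (0 : ℝ) < 4 ^ k := by positivity
      linarith
  choose n hn P hP using key
  refine ⟨n, ⟨P, ?_⟩, hn⟩
  refine squeeze_zero (fun r => ?_) hP tendsto_one_div_add_atTop_nhds_zero_nat
  rw [Protocol.errorProb_eq]
  exact Finset.sum_nonneg fun θ _ => mul_nonneg (by norm_num)
    (condError_nonneg (by linarith) (by linarith) _ _ _ _)

end highNoise

/-! ### From block lengths to velocities -/

section velocity

lemma velocity_le {ε : ℝ} (hε : ε < 1 / 2) : ∃ R : ℕ, ∀ δ : ℝ, 0 < δ → δ < 1 →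
    ∀ r, R ≤ r → ∀ (n : ℕ) (P : Protocol r n), P.errorProb ((1 - δ) / 2) ≤ ε →
      0 < n ∧ ((r + 1 : ℕ) : ℝ) / n ≤ 2 * δ ^ 2 := by
  obtain ⟨R, hR⟩ := exists_forall_hops_le hε
  refine ⟨R, fun δ h0 h1 r hr n P hP => ?_⟩
  have h := hR δ h0.le h1 r hr n P hP
  refine ⟨Nat.pos_of_ne_zero ?_, div_le_of_le_mul₀ (by positivity) (by positivity) h⟩
  rintro rfl
  push_cast at h
  have : (0 : ℝ) ≤ r := by positivity
  linarith

lemma le_velocity {δ : ℝ} {n r : ℕ} (hn : 0 < n)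
    (h : (n : ℝ) * δ ^ 2 ≤ 756 * ((r + 1 : ℕ) : ℝ)) :
    δ ^ 2 / 756 ≤ ((r + 1 : ℕ) : ℝ) / n := by
  have : (0 : ℝ) < n := Nat.cast_pos.2 hn
  rw [div_le_div_iff₀ (by norm_num) this]
  linarith

/-- Eventual bounds on a real sequence carry over to its lower and upper limits. -/
lemma liminf_limsup_mem_Icc {u : ℕ → ℝ} {a b : ℝ} (ha : ∀ᶠ r in atTop, a ≤ u r)
    (hb : ∀ᶠ r in atTop, u r ≤ b) :
    liminf u atTop ∈ Set.Icc a b ∧ limsup u atTop ∈ Set.Icc a b := by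
  have h1 : IsBoundedUnder (· ≤ ·) atTop u := ⟨b, by simpa using hb⟩
  have h2 : IsBoundedUnder (· ≥ ·) atTop u := ⟨a, by simpa using ha⟩
  have h3 : a ≤ liminf u atTop := le_liminf_of_le h1.isCoboundedUnder_ge ha
  have h4 : limsup u atTop ≤ b := limsup_le_of_le h2.isCoboundedUnder_le hb
  have h5 : liminf u atTop ≤ limsup u atTop := liminf_le_limsup h1 h2
  exact ⟨⟨h3, h5.trans h4⟩, ⟨h3.trans h5, h4⟩⟩

/-- A scheme with vanishing error eventually has error at most `ε`, so its block lengths bound the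
minimum from above. It also makes the set of feasible lengths nonempty, so the infimum is attained
and the converse applies to it. -/
lemma velocity_bounds {ε : ℝ} (hε0 : 0 < ε) (hε : ε < 1 / 2) {δ : ℝ} (h0 : 0 < δ) (h1 : δ < 1) :
    lowerVelocity ε ((1 - δ) / 2) ∈ Set.Icc (δ ^ 2 / 756) (2 * δ ^ 2) ∧
      upperVelocity ε ((1 - δ) / 2) ∈ Set.Icc (δ ^ 2 / 756) (2 * δ ^ 2) := by
  obtain ⟨R, hR⟩ := velocity_le hε
  obtain ⟨n, ⟨P, hP⟩, hn⟩ := exists_hasVanishingError h0 h1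
  have hev : ∀ᶠ r in atTop, (P r).errorProb ((1 - δ) / 2) ≤ ε :=
    (hP.eventually_lt_const hε0).mono fun r hr => hr.le
  have hmem : ∀ᶠ r in atTop, 0 < minBlockLength ε ((1 - δ) / 2) r ∧
      ((r + 1 : ℕ) : ℝ) / (minBlockLength ε ((1 - δ) / 2) r : ℝ) ≤ 2 * δ ^ 2 ∧
      minBlockLength ε ((1 - δ) / 2) r ≤ n r := by
    filter_upwards [hev, eventually_ge_atTop R] with r hr hRr
    have hin : n r ∈ {n : ℕ | ∃ P : Protocol r n, P.errorProb ((1 - δ) / 2) ≤ ε} := ⟨P r, hr⟩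
    obtain ⟨Q, hQ⟩ := Nat.sInf_mem ⟨_, hin⟩
    obtain ⟨h2, h3⟩ := hR δ h0 h1 r hRr _ Q hQ
    exact ⟨h2, h3, Nat.sInf_le hin⟩
  refine liminf_limsup_mem_Icc (hmem.mono fun r hr => ?_) (hmem.mono fun r hr => hr.2.1)
  refine le_velocity hr.1 (le_trans ?_ (hn r))
  gcongr
  exact hr.2.2

lemma HasVanishingError.velocity_le {δ : ℝ} (h0 : 0 < δ) (h1 : δ < 1) {n : ℕ → ℕ}
    (h : HasVanishingError ((1 - δ) / 2) n) :
    ∀ᶠ r in atTop, 0 < n r ∧ ((r + 1 : ℕ) : ℝ) / (n r : ℝ) ≤ 2 * δ ^ 2 := by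
  obtain ⟨R, hR⟩ := BitRelay.velocity_le (ε := 1 / 3) (by norm_num)
  obtain ⟨P, hP⟩ := h
  filter_upwards [hP.eventually_lt_const (show (0 : ℝ) < 1 / 3 by norm_num),
    eventually_ge_atTop R] with r hr hRr
  exact hR δ h0 h1 r hRr _ (P r) hr.le

lemma vanishingVelocity_bounds {δ : ℝ} (h0 : 0 < δ) (h1 : δ < 1) :
    lowerVanishingVelocity ((1 - δ) / 2) ∈ Set.Icc (δ ^ 2 / 756) (2 * δ ^ 2) ∧
      upperVanishingVelocity ((1 - δ) / 2) ∈ Set.Icc (δ ^ 2 / 756) (2 * δ ^ 2) := by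
  have hub : ∀ n : ℕ → ℕ, HasVanishingError ((1 - δ) / 2) n →
      liminf (fun r : ℕ => ((r + 1 : ℕ) : ℝ) / (n r : ℝ)) atTop ≤ 2 * δ ^ 2 ∧
      limsup (fun r : ℕ => ((r + 1 : ℕ) : ℝ) / (n r : ℝ)) atTop ≤ 2 * δ ^ 2 := by
    intro n hn
    -- The lower bound 0 serves only to keep the sequence bounded, as real-valued lower and upper
    -- limits require.
    obtain ⟨h2, h3⟩ := liminf_limsup_mem_Icc (u := fun r : ℕ => ((r + 1 : ℕ) : ℝ) / (n r : ℝ))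
      (a := 0) (Eventually.of_forall fun r => by positivity)
      ((hn.velocity_le h0 h1).mono fun r hr => hr.2)
    exact ⟨h2.2, h3.2⟩
  obtain ⟨n, hn, hnb⟩ := exists_hasVanishingError h0 h1
  obtain ⟨hlo, hup⟩ := liminf_limsup_mem_Icc (u := fun r : ℕ => ((r + 1 : ℕ) : ℝ) / (n r : ℝ))
    ((hn.velocity_le h0 h1).mono fun r hr => le_velocity hr.1 (hnb r))
    ((hn.velocity_le h0 h1).mono fun r hr => hr.2)
  -- The converse bounds the set above and the scheme makes it nonempty, so `sSup` is a genuine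
  -- supremum.
  have hset : ∀ {S : Set ℝ} {v : ℝ}, (∀ w ∈ S, w ≤ 2 * δ ^ 2) → v ∈ S → δ ^ 2 / 756 ≤ v →
      sSup S ∈ Set.Icc (δ ^ 2 / 756) (2 * δ ^ 2) := fun hS hv hle =>
    ⟨le_csSup_of_le ⟨_, hS⟩ hv hle, csSup_le ⟨_, hv⟩ hS⟩
  refine ⟨hset ?_ ⟨n, hn, rfl⟩ hlo.1, hset ?_ ⟨n, hn, rfl⟩ hup.1⟩
  · rintro _ ⟨n', hn', rfl⟩
    exact (hub n' hn').1
  · rintro _ ⟨n', hn', rfl⟩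
    exact (hub n' hn').2

lemma isTheta_sq_of_mem_Icc {v : ℝ → ℝ} {a b : ℝ} (ha : 0 < a)
    (h : ∀ δ, 0 < δ → δ < 1 → v δ ∈ Set.Icc (δ ^ 2 / a) (b * δ ^ 2)) :
    v =Θ[𝓝[>] 0] fun δ : ℝ => δ ^ 2 := by
  have hev : ∀ᶠ δ : ℝ in 𝓝[>] 0, 0 < δ ∧ δ < 1 := Ioo_mem_nhdsGT one_pos
  have hpos : ∀ δ, 0 < δ → δ < 1 → 0 ≤ v δ := fun δ h0 h1 =>
    le_trans (by positivity) (h δ h0 h1).1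
  refine ⟨IsBigO.of_bound b (hev.mono fun δ hδ => ?_), IsBigO.of_bound a (hev.mono fun δ hδ => ?_)⟩
  · rw [Real.norm_of_nonneg (hpos δ hδ.1 hδ.2), Real.norm_of_nonneg (sq_nonneg δ)]
    exact (h δ hδ.1 hδ.2).2
  · rw [Real.norm_of_nonneg (hpos δ hδ.1 hδ.2), Real.norm_of_nonneg (sq_nonneg δ)]
    exact (div_le_iff₀' ha).1 (h δ hδ.1 hδ.2).1

end velocity

end BitRelay

theorem theorem3 :
    (∀ ε : ℝ, 0 < ε → ε < 1 / 2 →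
      ((fun δ : ℝ => BitRelay.lowerVelocity ε ((1 - δ) / 2)) =Θ[𝓝[>] 0] fun δ : ℝ => δ ^ 2) ∧
      ((fun δ : ℝ => BitRelay.upperVelocity ε ((1 - δ) / 2)) =Θ[𝓝[>] 0] fun δ : ℝ => δ ^ 2)) ∧
    ((fun δ : ℝ => BitRelay.lowerVanishingVelocity ((1 - δ) / 2))
      =Θ[𝓝[>] 0] fun δ : ℝ => δ ^ 2) ∧
    ((fun δ : ℝ => BitRelay.upperVanishingVelocity ((1 - δ) / 2))
      =Θ[𝓝[>] 0] fun δ : ℝ => δ ^ 2) := by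
  refine ⟨fun ε hε0 hε => ⟨?_, ?_⟩, ?_, ?_⟩ <;>
    refine BitRelay.isTheta_sq_of_mem_Icc (a := 756) (b := 2) (by norm_num) fun δ h0 h1 => ?_
  · exact (BitRelay.velocity_bounds hε0 hε h0 h1).1
  · exact (BitRelay.velocity_bounds hε0 hε h0 h1).2
  · exact (BitRelay.vanishingVelocity_bounds h0 h1).1
  · exact (BitRelay.vanishingVelocity_bounds h0 h1).2
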